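/- \textbf{Setting.} Let $\mathcal X\subset\mathbb R^{d_x}$, $\mathcal Y\subset\mathbb R^{d_y}$, $\mathcal W\subset\mathbb R^{d_w}$ be Borel sets, $s\ge 0$ an integer, $\Theta\subset\mathbb R^{d}$, $\theta^*\in\Theta$. For each $\theta\in\Theta$ let $\mathbb P_\theta$ be a probability measure on the path space $(\mathcal X\times\mathcal Y\times\mathcal W)^{\mathbb Z}$ with coordinate process $(X_k,Y_k,W_k)_{k\in\mathbb Z}$. Write $\mathbf U_a^b=(U_a,\dots,U_b)$, $\overline{\mathbf Y}_k=(Y_k,\dots,Y_{k-s+1})$ and $\overline{\mathbf Y}_a^b=(\overline{\mathbf Y}_a,\dots,\overline{\mathbf Y}_b)$. Let $Q_\theta$ be a Markov transition kernel on $\mathcal X$, $\mu$ a probability measure on $\mathcal X$, $\nu$ a $\sigma$-finite measure on $\mathcal Y$, and $g_\theta(y\mid\overline{\mathbf y},x,w)\ge 0$ a jointly measurable function of $(y,\overline{\mathbf y},x,w)\in\mathcal Y\times\mathcal Y^s\times\mathcal X\times\mathcal W$ for each $\theta$. Put $$b_+(y,\overline{\mathbf y},w)=\sup_{\theta\in\Theta}\sup_{x\in\mathcal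 X}g_\theta(y\mid\overline{\mathbf y},x,w),\qquad b_-(y,\overline{\mathbf y},w)=\inf_{\theta\in\Theta}\inf_{x\in\mathcal X}g_\theta(y\mid\overline{\mathbf y},x,w).$$ \textbf{Assumptions.} (1) $\Theta$ is compact and $\theta^*$ lies in its interior; $\mathcal X$ is compact; for every $\theta\in\Theta$ and $k\ge1$, $Q_\theta$ is the transition kernel of $X_k$ given $X_{k-1}$ under $\mathbb P_\theta$; for every $\theta$, $r\ge1$ and $x$, the $r$-step kernel $Q_\theta^r(x,\cdot)$ has a density $q_\theta^r(x,\cdot)$ with respect to $\mu$, with $q^r_\theta$ finite, nonnegative and jointly measurable; with $q_\theta=q_\theta^1$, $\sup_{\theta,x,x'}q_\theta(x,x')<\infty$; and for some integer $p\ge 1$, $0<\inf_{\theta,x,x'}q^p_\theta(x,x')$ and $\sup_{\theta,x,x'}q^p_\theta(x,x')<\infty$. (2) For every $\theta\in\Theta$, under $\mathbb P_\theta$: (a) for $k\ge1$, $X_k$ is conditionally independent of $(\mathbf X_0^{k-2},\overline{\mathbf Y}_0^{k-1},\mathbf W_0^\infty)$ given $X_{k-1}$; (b) for $k\ge1$,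 $Y_k$ is conditionally independent of $(\mathbf Y_{-s+1}^{k-s-1},\mathbf X_0^{k-1},\mathbf W_0^{k-1},\mathbf W_{k+1}^\infty)$ given $(\overline{\mathbf Y}_{k-1},X_k,W_k)$, and the conditional law of $Y_k$ given these variables has density $g_\theta(\cdot\mid\overline{\mathbf Y}_{k-1},X_k,W_k)$ with respect to $\nu$; (c) $\mathbf W_1^\infty$ is conditionally independent of $(\overline{\mathbf Y}_0,X_0)$ given $W_0$; (d) the process $(X_k,Y_k,W_k)_{k\in\mathbb Z}$ is strictly stationary, and it is ergodic under $\mathbb P_{\theta^*}$. (3) $0<b_-(y,\overline{\mathbf y},w)$ and $b_+(y,\overline{\mathbf y},w)<\infty$ for all $y\in\mathcal Y$, $\overline{\mathbf y}\in\mathcal Y^s$, $w\in\mathcal W$. (4) $\mathbb E_{\theta^*}|\log b_+(Y_1,\overline{\mathbf Y}_0,W_1)|<\infty$ and $\mathbb E_{\theta^*}|\log b_-(Y_1,\overline{\mathbf Y}_0,W_1)|<\infty$. (5) There are constants $\alpha,C_1,C_2>0$ and $\beta>1$ such that for all $r>0$, $\mathbb P_{\theta^*}\big(b_+(Y_1,\overline{\mathbf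 Y}_0,W_1)/b_-(Y_1,\overline{\mathbf Y}_0,W_1)\ge C_1e^{\alpha r}\big)\le C_2r^{-\beta}$. \textbf{Log-likelihoods.} For $x_0\in\mathcal X$ let $$p_\theta(\mathbf Y_1^n\mid\overline{\mathbf Y}_0,\mathbf W_0^n,x_0)=\int_{\mathcal X^n}\prod_{k=1}^n q_\theta(x_{k-1},x_k)\,g_\theta(Y_k\mid\overline{\mathbf Y}_{k-1},x_k,W_k)\,\mu^{\otimes n}(d\mathbf x_1^n),\qquad l_n(\theta,x_0)=\log p_\theta(\mathbf Y_1^n\mid\overline{\mathbf Y}_0,\mathbf W_0^n,x_0),$$ and let the stationary log-likelihood be $$l_n(\theta)=\log p_\theta(\mathbf Y_1^n\mid\overline{\mathbf Y}_0,\mathbf W_0^n)=\log\int_{\mathcal X}p_\theta(\mathbf Y_1^n\mid\overline{\mathbf Y}_0,\mathbf W_0^n,x_0)\,\mathbb P_\theta(X_0\in dx_0\mid\overline{\mathbf Y}_0,\mathbf W_0^n),$$ where $\mathbb P_\theta(X_0\in\cdot\mid\overline{\mathbf Y}_0,\mathbf W_0^n)$ is any version of the regular conditional distribution of $X_0$ under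 $\mathbb P_\theta$. \textbf{Lemma.} Under assumptions (1)--(5), for every choice of these versions, $$n^{-1}\sup_{x_0\in\mathcal X}\sup_{\theta\in\Theta}|l_n(\theta,x_0)-l_n(\theta)|\to0\quad\text{as }n\to\infty,\qquad\mathbb P_{\theta^*}\text{-almost surely.}$$ -/

import Mathlib

open MeasureTheory ProbabilityTheory Filter Topology
open scoped ENNReal

noncomputable section

/-- The primitives of a Markov regime switching model with hidden states `X k`, observations `Y k`
and covariates `W k`, on the canonical two-sided path space: state spaces that are subsets of
Euclidean spaces, a parameter set, a law of the whole path for each parameter value, transition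
kernels and densities of the hidden chain, and the regime-specific observation densities. The
conditions that relate these data to one another are stated as predicates below. -/
structure RegimeSwitchingModel where
  /-- dimension of the parameter -/
  dΘ : ℕ
  /-- dimension of the hidden state -/
  dX : ℕ
  /-- dimension of the observation -/
  dY : ℕ
  /-- dimension of the covariate -/
  dW : ℕ
  /-- number of lags of the observation -/
  s : ℕ
  /-- parameter set -/
  Θ : Set (EuclideanSpace ℝ (Fin dΘ))
  /-- true parameter value -/
  θstar : Θ
  /-- state space of the hidden chain -/
  𝒳 : Set (EuclideanSpace ℝ (Fin dX))
  /-- state space of the observations -/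
  𝒴 : Set (EuclideanSpace ℝ (Fin dY))
  /-- state space of the covariates -/
  𝒲 : Set (EuclideanSpace ℝ (Fin dW))
  measurableSet_𝒳 : MeasurableSet 𝒳
  measurableSet_𝒴 : MeasurableSet 𝒴
  measurableSet_𝒲 : MeasurableSet 𝒲
  /-- law of the path `(X k, Y k, W k)`, `k ∈ ℤ`, under the parameter `θ` -/
  P : Θ → Measure (ℤ → 𝒳 × 𝒴 × 𝒲)
  isProbabilityMeasure_P : ∀ θ, IsProbabilityMeasure (P θ)
  /-- dominating measure on the hidden state space, of total mass one -/
  μ : Measure 𝒳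
  isProbabilityMeasure_μ : IsProbabilityMeasure μ
  /-- dominating measure on the observation space -/
  ν : Measure 𝒴
  sigmaFinite_ν : SigmaFinite ν
  /-- transition kernel of the hidden chain -/
  Q : Θ → Kernel 𝒳 𝒳
  isMarkovKernel_Q : ∀ θ, IsMarkovKernel (Q θ)
  /-- `q θ r x x'` is the `r`-step transition density of the hidden chain, for `r ≥ 1` -/
  q : Θ → ℕ → 𝒳 → 𝒳 → ℝ
  q_nonneg : ∀ θ r x x', 0 ≤ q θ r x x'
  measurable_q : ∀ θ r, Measurable fun z : 𝒳 × 𝒳 => q θ r z.1 z.2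
  /-- `g θ y ybar x w` is the density at `y` of `Y k` given that the lagged observations are `ybar`,
  the hidden state is `x` and the covariate is `w` -/
  g : Θ → 𝒴 → (Fin s → 𝒴) → 𝒳 → 𝒲 → ℝ
  g_nonneg : ∀ θ y ybar x w, 0 ≤ g θ y ybar x w
  measurable_g : ∀ θ, Measurable fun z : 𝒴 × (Fin s → 𝒴) × 𝒳 × 𝒲 =>
    g θ z.1 z.2.1 z.2.2.1 z.2.2.2

namespace RegimeSwitchingModel

variable (M : RegimeSwitchingModel)

/-- The canonical path space. -/
abbrev Path : Type := ℤ → M.𝒳 × M.𝒴 × M.𝒲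

instance (θ : M.Θ) : IsProbabilityMeasure (M.P θ) := M.isProbabilityMeasure_P θ
instance : IsProbabilityMeasure M.μ := M.isProbabilityMeasure_μ
instance : SigmaFinite M.ν := M.sigmaFinite_ν
instance (θ : M.Θ) : IsMarkovKernel (M.Q θ) := M.isMarkovKernel_Q θ
instance : StandardBorelSpace M.𝒳 := M.measurableSet_𝒳.standardBorel
instance : StandardBorelSpace M.𝒴 := M.measurableSet_𝒴.standardBorel
instance : StandardBorelSpace M.𝒲 := M.measurableSet_𝒲.standardBorel

/-- The hidden state at time `k`. -/
def X (k : ℤ) (ω : M.Path) : M.𝒳 := (ω k).1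

/-- The observation at time `k`. -/
def Y (k : ℤ) (ω : M.Path) : M.𝒴 := (ω k).2.1

/-- The covariate at time `k`. -/
def W (k : ℤ) (ω : M.Path) : M.𝒲 := (ω k).2.2

/-- The vector `(Y k, Y (k - 1), …, Y (k - s + 1))`. -/
def Ybar (k : ℤ) (ω : M.Path) : Fin M.s → M.𝒴 := fun j => M.Y (k - (j : ℕ)) ω

/-- The values of a process `U` at the times in `I`. -/
def block {E : Type} (U : ℤ → M.Path → E) (I : Set ℤ) (ω : M.Path) : I → E := fun i => U i ω

/-- The time shift on the path space. -/
def shift (ω : M.Path) : M.Path := fun k => ω (k + 1)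

@[fun_prop]
lemma measurable_X (k : ℤ) : Measurable (M.X k) := by unfold X; fun_prop

@[fun_prop]
lemma measurable_Y (k : ℤ) : Measurable (M.Y k) := by unfold Y; fun_prop

@[fun_prop]
lemma measurable_W (k : ℤ) : Measurable (M.W k) := by unfold W; fun_prop

@[fun_prop]
lemma measurable_Ybar (k : ℤ) : Measurable (M.Ybar k) := by
  unfold Ybar; exact measurable_pi_lambda _ fun j => M.measurable_Y _

/-- The variables `(Ybar (k - 1), X k, W k)` on which the conditional law of `Y k` depends. -/
def regressors (k : ℤ) (ω : M.Path) : (Fin M.s → M.𝒴) × M.𝒳 × M.𝒲 :=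
  (M.Ybar (k - 1) ω, M.X k ω, M.W k ω)

@[fun_prop]
lemma measurable_regressors (k : ℤ) : Measurable (M.regressors k) := by
  unfold regressors; fun_prop

/-- The kernel with density `g θ` with respect to `ν`. -/
def obsKernel (θ : M.Θ) : Kernel ((Fin M.s → M.𝒴) × M.𝒳 × M.𝒲) M.𝒴 :=
  (Kernel.const _ M.ν).withDensity fun c y => ENNReal.ofReal (M.g θ y c.1 c.2.1 c.2.2)

/-- Conditions on the parameter set and on the hidden Markov chain: compactness, transition
densities with respect to `μ`, a bounded one-step density, and, for some `p ≥ 1`, a `p`-step density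
that is bounded and bounded away from zero, uniformly in the parameter and in the states. The
transition probabilities of the chain `X` under `P θ` are those of the kernel `Q θ`; the Markov
property is part of `DependenceAssumptions.condIndep_X`. -/
structure ChainAssumptions : Prop where
  isCompact_Θ : IsCompact M.Θ
  θstar_mem_interior : (M.θstar : EuclideanSpace ℝ (Fin M.dΘ)) ∈ interior M.Θ
  isCompact_𝒳 : IsCompact M.𝒳
  transition : ∀ θ : M.Θ, ∀ k : ℤ, 1 ≤ k →
    HasCondDistrib (M.X k) (M.X (k - 1)) (M.Q θ) (M.P θ)
  density : ∀ θ : M.Θ, ∀ r : ℕ, 1 ≤ r → ∀ x : M.𝒳,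
    (M.Q θ ^ r) x = M.μ.withDensity fun x' => ENNReal.ofReal (M.q θ r x x')
  bounded_one_step : ∃ σ : ℝ, ∀ (θ : M.Θ) (x x' : M.𝒳), M.q θ 1 x x' ≤ σ
  bounds_p_step : ∃ p : ℕ, 1 ≤ p ∧ ∃ σminus σplus : ℝ, 0 < σminus ∧
    ∀ (θ : M.Θ) (x x' : M.𝒳), σminus ≤ M.q θ p x x' ∧ M.q θ p x x' ≤ σplus

/-- Conditional independence structure of the model, the conditional density of the observations,
stationarity under every parameter value, and ergodicity under the true one. -/
structure DependenceAssumptions : Prop where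
  /-- `X k` is independent of the past and of all covariates given `X (k - 1)`. -/
  condIndep_X : ∀ θ : M.Θ, ∀ k : ℤ, 1 ≤ k →
    M.X k ⟂ᵢ[M.X (k - 1), M.measurable_X (k - 1); M.P θ]
      fun ω => (M.block M.X (Set.Icc 0 (k - 2)) ω, M.block M.Ybar (Set.Icc 0 (k - 1)) ω,
        M.block M.W (Set.Ici 0) ω)
  /-- `Y k` is independent of the rest of the past, and of the other covariates, given
  `(Ybar (k - 1), X k, W k)`. -/
  condIndep_Y : ∀ θ : M.Θ, ∀ k : ℤ, 1 ≤ k →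
    M.Y k ⟂ᵢ[M.regressors k, M.measurable_regressors k; M.P θ]
      fun ω => (M.block M.Y (Set.Icc (-M.s + 1) (k - M.s - 1)) ω,
        M.block M.X (Set.Icc 0 (k - 1)) ω, M.block M.W (Set.Icc 0 (k - 1)) ω,
        M.block M.W (Set.Ici (k + 1)) ω)
  density_Y : ∀ θ : M.Θ, ∀ k : ℤ, 1 ≤ k →
    HasCondDistrib (M.Y k) (M.regressors k) (M.obsKernel θ) (M.P θ)
  /-- The future covariates are independent of the initial state given the initial covariate. -/
  condIndep_W : ∀ θ : M.Θ,
    M.block M.W (Set.Ici 1) ⟂ᵢ[M.W 0, M.measurable_W 0; M.P θ] fun ω => (M.Ybar 0 ω, M.X 0 ω)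
  stationary : ∀ θ : M.Θ, MeasurePreserving M.shift (M.P θ) (M.P θ)
  ergodic : Ergodic M.shift (M.P M.θstar)

/-- `sup_θ sup_x g_θ(y | ybar, x, w)`. -/
def bPlus (y : M.𝒴) (ybar : Fin M.s → M.𝒴) (w : M.𝒲) : ℝ :=
  ⨆ i : M.Θ × M.𝒳, M.g i.1 y ybar i.2 w

/-- `inf_θ inf_x g_θ(y | ybar, x, w)`. -/
def bMinus (y : M.𝒴) (ybar : Fin M.s → M.𝒴) (w : M.𝒲) : ℝ :=
  ⨅ i : M.Θ × M.𝒳, M.g i.1 y ybar i.2 w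

/-- The observation density is bounded, and bounded away from zero, in the parameter and the hidden
state, for each value of the other arguments. -/
def DensityBounds : Prop :=
  ∀ (y : M.𝒴) (ybar : Fin M.s → M.𝒴) (w : M.𝒲), 0 < M.bMinus y ybar w ∧
    BddAbove (Set.range fun i : M.Θ × M.𝒳 => M.g i.1 y ybar i.2 w)

/-- First moments of the logarithms of the extremal densities, under the true parameter. -/
def LogMoments : Prop :=
  Integrable (fun ω => Real.log (M.bPlus (M.Y 1 ω) (M.Ybar 0 ω) (M.W 1 ω))) (M.P M.θstar) ∧
  Integrable (fun ω => Real.log (M.bMinus (M.Y 1 ω) (M.Ybar 0 ω) (M.W 1 ω))) (M.P M.θstar)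

/-- Tail bound for the ratio of the extremal densities, under the true parameter. -/
def RatioTail : Prop :=
  ∃ α C₁ C₂ β : ℝ, 0 < α ∧ 0 < C₁ ∧ 0 < C₂ ∧ 1 < β ∧ ∀ r : ℝ, 0 < r →
    (M.P M.θstar).real {ω | C₁ * Real.exp (α * r) ≤
      M.bPlus (M.Y 1 ω) (M.Ybar 0 ω) (M.W 1 ω) / M.bMinus (M.Y 1 ω) (M.Ybar 0 ω) (M.W 1 ω)}
      ≤ C₂ * r ^ (-β)

/-- The conditional density of `(Y 1, …, Y n)` given `Ybar 0`, `(W 0, …, W n)` and `X 0 = x₀`,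
evaluated along the path `ω`: the integral over `(x 1, …, x n)`, with respect to the `n`-fold
product of `μ`, of `∏ q θ (x (k-1)) (x k) * g θ (Y k | Ybar (k-1), x k, W k)`, with `x 0 = x₀`.
The variable `x k` of this formula is `x ⟨k - 1, _⟩` below. -/
def condDensity (n : ℕ) (θ : M.Θ) (x₀ : M.𝒳) (ω : M.Path) : ℝ :=
  ∫ x : Fin n → M.𝒳, ∏ k : Fin n,
      (M.q θ 1 ((Fin.cons x₀ x : Fin (n + 1) → M.𝒳) k.castSucc) (x k) *
        M.g θ (M.Y ((k : ℕ) + 1) ω) (M.Ybar (k : ℕ) ω) (x k) (M.W ((k : ℕ) + 1) ω))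
    ∂(Measure.pi fun _ => M.μ)

/-- The conditional log-likelihood `l_n(θ, x₀)`. -/
def condLogLik (n : ℕ) (θ : M.Θ) (x₀ : M.𝒳) (ω : M.Path) : ℝ :=
  Real.log (M.condDensity n θ x₀ ω)

/-- The conditioning variables `(Ybar 0, (W 0, …, W n))`. -/
def initialData (n : ℕ) (ω : M.Path) : (Fin M.s → M.𝒴) × (Set.Icc (0 : ℤ) n → M.𝒲) :=
  (M.Ybar 0 ω, M.block M.W (Set.Icc 0 n) ω)

/-- `κ θ n` is a version of the regular conditional distribution, under `P θ`, of `X 0` given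
`Ybar 0` and `(W 0, …, W n)`. -/
structure IsInitialLaw
    (κ : M.Θ → ∀ n : ℕ, Kernel ((Fin M.s → M.𝒴) × (Set.Icc (0 : ℤ) n → M.𝒲)) M.𝒳) : Prop where
  isMarkovKernel : ∀ θ n, IsMarkovKernel (κ θ n)
  hasCondDistrib : ∀ θ n, HasCondDistrib (M.X 0) (M.initialData n) (κ θ n) (M.P θ)

/-- The stationary log-likelihood `l_n(θ)`: the logarithm of the conditional density of
`(Y 1, …, Y n)` given `Ybar 0` and `(W 0, …, W n)` under the stationary law `P θ`, obtained by
integrating `x₀` out against the conditional law of `X 0`. -/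
def statLogLik
    (κ : M.Θ → ∀ n : ℕ, Kernel ((Fin M.s → M.𝒴) × (Set.Icc (0 : ℤ) n → M.𝒲)) M.𝒳)
    (n : ℕ) (θ : M.Θ) (ω : M.Path) : ℝ :=
  Real.log (∫ x₀, M.condDensity n θ x₀ ω ∂(κ θ n (M.initialData n ω)))

end RegimeSwitchingModel

end

open MeasureTheory ProbabilityTheory Filter Topology
open scoped ENNReal

/-! Changing the initial state alters the likelihood by a factor that stays bounded as `n` grows.
Cut the likelihood at the time `p` of the two-sided bound on the `p`-step density. Given the state
at time `p`, the later observations contribute a function `F` of that state which does not involve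
`x₀`. Replacing the first `p` observation densities by their extrema over parameter and state leaves
a `p`-step transition applied to `F`, and this is comparable to `A = ∫ F dμ`. So the likelihood lies
in `[c * A, C * A]` for every `x₀`, where `A` may depend on `n` and `θ`, but `c` and `C` depend only
on the first `p` observations and their regressors (`exists_condDensity_mem_Icc`). The stationary
likelihood averages these values against a probability measure, so it lies in the same interval. The
logarithms differ by at most `log (C / c)`, on every path, and division by `n` gives the limit. -/

lemma measurable_cons_apply {α : Type*} [MeasurableSpace α] {n : ℕ} (z : α) (k : Fin (n + 1)) :
    Measurable fun x : Fin n → α => (Fin.cons z x : Fin (n + 1) → α) k := by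
  refine Fin.cases ?_ (fun j => ?_) k
  · simp
  · simpa only [Fin.cons_succ] using measurable_pi_apply j

/-! ### Backward recursion for weighted Markov chains. -/

namespace ProbabilityTheory.Kernel

variable {α : Type*} [MeasurableSpace α]

/-- The backward recursion of a hidden Markov model: integrate `G 0 (x 1) * ⋯ * G (n - 1) (x n) * f (x n)`
over `n` steps of the chain with transition kernel `η` started at `x`. -/
noncomputable def feynmanKac (η : Kernel α α) (f : α → ℝ≥0∞) : ℕ → (ℕ → α → ℝ≥0∞) → α → ℝ≥0∞
  | 0, _, x => f x
  | n + 1, G, x => ∫⁻ y, G 0 y * feynmanKac η f n (fun k => G (k + 1)) y ∂η x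

lemma measurable_feynmanKac (η : Kernel α α) {f : α → ℝ≥0∞} (hf : Measurable f) (n : ℕ)
    {G : ℕ → α → ℝ≥0∞} (hG : ∀ k, Measurable (G k)) : Measurable (η.feynmanKac f n G) := by
  induction n generalizing G with
  | zero => exact hf
  | succ n ih => exact ((hG 0).mul (ih fun k => hG (k + 1))).lintegral_kernel

/-- Markov property at time `m`: the last `n` steps enter only through a function of the state
reached at time `m`, which becomes the new terminal function. -/
lemma feynmanKac_add (η : Kernel α α) (f : α → ℝ≥0∞) (m n : ℕ) (G : ℕ → α → ℝ≥0∞) :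
    η.feynmanKac f (m + n) G = η.feynmanKac (η.feynmanKac f n fun k => G (k + m)) m G := by
  induction m generalizing G with
  | zero => rw [Nat.zero_add]; rfl
  | succ m ih =>
    rw [Nat.add_right_comm]
    funext x
    simp only [feynmanKac, ih, Nat.add_assoc]

lemma lintegral_pow_zero (η : Kernel α α) (x : α) {f : α → ℝ≥0∞} (hf : Measurable f) :
    ∫⁻ y, f y ∂(η ^ 0) x = f x := lintegral_dirac' x hf

instance isMarkovKernel_pow (η : Kernel α α) [IsMarkovKernel η] (n : ℕ) :
    IsMarkovKernel (η ^ n) := by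
  induction n with
  | zero => exact inferInstanceAs (IsMarkovKernel Kernel.id)
  | succ n ih =>
    rw [pow_succ]
    exact inferInstanceAs (IsMarkovKernel ((η ^ n) ∘ₖ η))

lemma lintegral_pow_succ (η : Kernel α α) (n : ℕ) (x : α) {f : α → ℝ≥0∞} (hf : Measurable f) :
    ∫⁻ y, f y ∂(η ^ (n + 1)) x = ∫⁻ z, ∫⁻ y, f y ∂(η ^ n) z ∂η x := by
  rw [pow_succ]
  exact lintegral_comp (η ^ n) η x hf

/-- Constant weights factor out of the recursion and leave the bare `n`-step transition. This brings
in the `p`-step density; the one-step density may vanish. -/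
lemma prod_mul_lintegral_pow_le_feynmanKac (η : Kernel α α) {f : α → ℝ≥0∞} (hf : Measurable f)
    (n : ℕ) {G : ℕ → α → ℝ≥0∞} {c : ℕ → ℝ≥0∞} (hc : ∀ k x, c k ≤ G k x) (x : α) :
    (∏ k ∈ Finset.range n, c k) * ∫⁻ y, f y ∂(η ^ n) x ≤ η.feynmanKac f n G x := by
  induction n generalizing G c x with
  | zero => rw [lintegral_pow_zero η x hf, Finset.prod_range_zero, one_mul, feynmanKac]
  | succ n ih =>
    rw [Finset.prod_range_succ', lintegral_pow_succ η n x hf, feynmanKac,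
      ← lintegral_const_mul _ hf.lintegral_kernel]
    refine lintegral_mono fun y => ?_
    rw [mul_comm _ (c 0), mul_assoc]
    exact mul_le_mul' (hc 0 y) (ih (fun k => hc (k + 1)) y)

lemma feynmanKac_le_prod_mul_lintegral_pow (η : Kernel α α) {f : α → ℝ≥0∞} (hf : Measurable f)
    (n : ℕ) {G : ℕ → α → ℝ≥0∞} {c : ℕ → ℝ≥0∞} (hc : ∀ k x, G k x ≤ c k) (x : α) :
    η.feynmanKac f n G x ≤ (∏ k ∈ Finset.range n, c k) * ∫⁻ y, f y ∂(η ^ n) x := by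
  induction n generalizing G c x with
  | zero => rw [lintegral_pow_zero η x hf, Finset.prod_range_zero, one_mul, feynmanKac]
  | succ n ih =>
    rw [Finset.prod_range_succ', lintegral_pow_succ η n x hf, feynmanKac,
      ← lintegral_const_mul _ hf.lintegral_kernel]
    refine lintegral_mono fun y => ?_
    rw [mul_comm _ (c 0), mul_assoc]
    exact mul_le_mul' (hc 0 y) (ih (fun k => hc (k + 1)) y)

/-- If `η` has density `q` with respect to `μ`, the backward recursion is an integral over the
product of `n` copies of `μ`. -/
lemma lintegral_pi_eq_feynmanKac (η : Kernel α α) (μ : Measure α) [SigmaFinite μ]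
    {q : α → α → ℝ≥0∞} (hq : Measurable (Function.uncurry q))
    (hη : ∀ x, η x = μ.withDensity (q x)) (n : ℕ) {G : ℕ → α → ℝ≥0∞}
    (hG : ∀ k, Measurable (G k)) (x₀ : α) :
    ∫⁻ x : Fin n → α, ∏ k : Fin n,
      (q ((Fin.cons x₀ x : Fin (n + 1) → α) k.castSucc) (x k) * G k (x k))
      ∂(Measure.pi fun _ => μ) = η.feynmanKac (fun _ => 1) n G x₀ := by
  induction n generalizing G x₀ with
  | zero => simp [feynmanKac]
  | succ n ih =>
    have hmeas (z : α) (G : ℕ → α → ℝ≥0∞) (hG : ∀ k, Measurable (G k)) (n : ℕ) :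
        Measurable fun x : Fin n → α => ∏ k : Fin n,
          (q ((Fin.cons z x : Fin (n + 1) → α) k.castSucc) (x k) * G k (x k)) := by
      refine Finset.measurable_prod _ fun k _ => ?_
      exact (hq.comp ((measurable_cons_apply z k.castSucc).prodMk (measurable_pi_apply k))).mul
        ((hG k).comp (measurable_pi_apply k))
    -- Splitting off the first coordinate `y`, which becomes the initial state of the remaining `n`
    -- steps, puts the integral in the form of the recursion.
    have e := (measurePreserving_piFinSuccAbove (fun _ : Fin (n + 1) => μ) 0).symm
    rw [← e.lintegral_comp (hmeas x₀ G hG (n + 1))]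
    refine (MeasureTheory.lintegral_prod _
      ((hmeas x₀ G hG (n + 1)).comp e.measurable).aemeasurable).trans ?_
    rw [feynmanKac, hη]
    refine Eq.trans ?_ (lintegral_withDensity_eq_lintegral_mul _ (Measurable.of_uncurry_left hq)
      ((hG 0).mul (measurable_feynmanKac η measurable_const n fun k => hG (k + 1)))).symm
    refine lintegral_congr fun y => ?_
    rw [Pi.mul_apply, Pi.mul_apply, ← ih (fun k => hG (k + 1)) y, ← mul_assoc,
      ← lintegral_const_mul _ (hmeas y _ (fun k => hG (k + 1)) n)]
    refine lintegral_congr fun x => ?_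
    simp only [Function.comp_apply, MeasurableEquiv.piFinSuccAbove_symm_apply, Fin.insertNthEquiv_zero,
      Fin.consEquiv_apply, Fin.prod_univ_succ]
    rfl

end ProbabilityTheory.Kernel

/-! ### Elementary estimates. -/

lemma Real.abs_log_sub_log_le_of_mem_Icc {l u a b : ℝ} (hl : 0 < l) (ha : a ∈ Set.Icc l u)
    (hb : b ∈ Set.Icc l u) : |Real.log a - Real.log b| ≤ Real.log (u / l) := by
  have ha0 := hl.trans_le ha.1
  have hb0 := hl.trans_le hb.1
  have h1 := Real.log_le_log hl ha.1
  have h2 := Real.log_le_log hl hb.1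
  have h3 := Real.log_le_log ha0 ha.2
  have h4 := Real.log_le_log hb0 hb.2
  rw [Real.log_div (ha0.trans_le ha.2).ne' hl.ne', abs_le]
  constructor <;> linarith

lemma ENNReal.tendsto_div_natCast_of_eventually_le {u : ℕ → ℝ≥0∞} {K : ℝ≥0∞} (hK : K ≠ ∞)
    (hu : ∀ᶠ n in atTop, u n ≤ K) : Tendsto (fun n : ℕ => u n / (n : ℝ≥0∞)) atTop (𝓝 0) := by
  have hlim : Tendsto (fun n : ℕ => K / (n : ℝ≥0∞)) atTop (𝓝 0) := by
    simpa only [div_eq_mul_inv, mul_zero] using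
      ENNReal.Tendsto.const_mul ENNReal.tendsto_inv_nat_nhds_zero (Or.inr hK)
  refine tendsto_of_tendsto_of_tendsto_of_le_of_le' tendsto_const_nhds hlim
    (Eventually.of_forall fun n => zero_le) ?_
  filter_upwards [hu] with n hn
  exact ENNReal.div_le_div_right hn _

/-! ### Comparison of the likelihoods over initial states. -/

namespace RegimeSwitchingModel

variable (M : RegimeSwitchingModel)

/-- The conditional density of the observation at time `k + 1` along the path `ω`, as a function of
the hidden state. -/
noncomputable def obsLik (θ : M.Θ) (ω : M.Path) (k : ℕ) (x : M.𝒳) : ℝ≥0∞ :=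
  ENNReal.ofReal (M.g θ (M.Y ((k : ℕ) + 1) ω) (M.Ybar (k : ℕ) ω) x (M.W ((k : ℕ) + 1) ω))

/-- The extremal density `bPlus` of the observation at time `k + 1` along the path `ω`. -/
noncomputable def pathBPlus (ω : M.Path) (k : ℕ) : ℝ :=
  M.bPlus (M.Y ((k : ℕ) + 1) ω) (M.Ybar (k : ℕ) ω) (M.W ((k : ℕ) + 1) ω)

/-- The extremal density `bMinus` of the observation at time `k + 1` along the path `ω`. -/
noncomputable def pathBMinus (ω : M.Path) (k : ℕ) : ℝ :=
  M.bMinus (M.Y ((k : ℕ) + 1) ω) (M.Ybar (k : ℕ) ω) (M.W ((k : ℕ) + 1) ω)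

variable {M}

lemma measurable_obsLik (θ : M.Θ) (ω : M.Path) (k : ℕ) : Measurable (M.obsLik θ ω k) :=
  ENNReal.measurable_ofReal.comp <| (M.measurable_g θ).comp <|
    measurable_const.prodMk <| measurable_const.prodMk <| measurable_id.prodMk measurable_const

lemma DensityBounds.pathBMinus_pos (h : M.DensityBounds) (ω : M.Path) (k : ℕ) :
    0 < M.pathBMinus ω k := (h _ _ _).1

lemma ofReal_pathBMinus_le_obsLik (θ : M.Θ) (ω : M.Path) (k : ℕ) (x : M.𝒳) :
    ENNReal.ofReal (M.pathBMinus ω k) ≤ M.obsLik θ ω k x := by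
  refine ENNReal.ofReal_le_ofReal (ciInf_le ⟨0, ?_⟩ (θ, x))
  rintro _ ⟨i, rfl⟩
  exact M.g_nonneg _ _ _ _ _

lemma DensityBounds.obsLik_le_ofReal_pathBPlus (h : M.DensityBounds) (θ : M.Θ) (ω : M.Path)
    (k : ℕ) (x : M.𝒳) : M.obsLik θ ω k x ≤ ENNReal.ofReal (M.pathBPlus ω k) :=
  ENNReal.ofReal_le_ofReal (le_ciSup (h _ _ _).2 (θ, x))

/-- The integrand is nonnegative and measurable, so the Bochner integral is the `toReal` of the
Lebesgue one; finiteness is not needed here. -/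
lemma ChainAssumptions.condDensity_eq (h : M.ChainAssumptions) (n : ℕ) (θ : M.Θ) (x₀ : M.𝒳)
    (ω : M.Path) :
    M.condDensity n θ x₀ ω = ((M.Q θ).feynmanKac (fun _ => 1) n (M.obsLik θ ω) x₀).toReal := by
  have hq : Measurable (Function.uncurry fun x x' => ENNReal.ofReal (M.q θ 1 x x')) :=
    ENNReal.measurable_ofReal.comp (M.measurable_q θ 1)
  rw [← Kernel.lintegral_pi_eq_feynmanKac (M.Q θ) M.μ hq
    (fun x => by simpa using h.density θ 1 le_rfl x) n (measurable_obsLik θ ω) x₀, condDensity,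
    integral_eq_lintegral_of_nonneg_ae]
  · congr 1
    refine lintegral_congr fun x => ?_
    rw [ENNReal.ofReal_prod_of_nonneg fun k _ => mul_nonneg (M.q_nonneg _ _ _ _)
      (M.g_nonneg _ _ _ _ _)]
    refine Finset.prod_congr rfl fun k _ => ?_
    rw [ENNReal.ofReal_mul (M.q_nonneg _ _ _ _)]
    rfl
  · exact Eventually.of_forall fun x => Finset.prod_nonneg fun k _ =>
      mul_nonneg (M.q_nonneg _ _ _ _) (M.g_nonneg _ _ _ _ _)
  · refine (Finset.measurable_prod _ fun k _ => ?_).aestronglyMeasurable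
    have hg : Measurable fun x => M.g θ (M.Y ((k : ℕ) + 1) ω) (M.Ybar (k : ℕ) ω) x
        (M.W ((k : ℕ) + 1) ω) :=
      (M.measurable_g θ).comp <| measurable_const.prodMk <| measurable_const.prodMk <|
        measurable_id.prodMk measurable_const
    exact ((M.measurable_q θ 1).comp ((measurable_cons_apply x₀ k.castSucc).prodMk
      (measurable_pi_apply k))).mul (hg.comp (measurable_pi_apply k))

lemma ChainAssumptions.measurable_condDensity (h : M.ChainAssumptions) (n : ℕ) (θ : M.Θ)
    (ω : M.Path) : Measurable fun x₀ => M.condDensity n θ x₀ ω := by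
  simp only [h.condDensity_eq]
  exact (Kernel.measurable_feynmanKac _ measurable_const n (measurable_obsLik θ ω)).ennreal_toReal

lemma feynmanKac_obsLik_pos (h : M.DensityBounds) (n : ℕ) (θ : M.Θ) (x₀ : M.𝒳) (ω : M.Path) :
    0 < (M.Q θ).feynmanKac (fun _ => 1) n (M.obsLik θ ω) x₀ := by
  refine lt_of_lt_of_le ?_ (Kernel.prod_mul_lintegral_pow_le_feynmanKac (M.Q θ) measurable_const n
    (ofReal_pathBMinus_le_obsLik θ ω) x₀)
  simp [pos_iff_ne_zero, Finset.prod_eq_zero_iff, h.pathBMinus_pos]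

lemma feynmanKac_obsLik_lt_top (h : M.DensityBounds) (n : ℕ) (θ : M.Θ) (x₀ : M.𝒳) (ω : M.Path) :
    (M.Q θ).feynmanKac (fun _ => 1) n (M.obsLik θ ω) x₀ < ∞ := by
  refine (Kernel.feynmanKac_le_prod_mul_lintegral_pow (M.Q θ) measurable_const n
    (h.obsLik_le_ofReal_pathBPlus θ ω) x₀).trans_lt ?_
  rw [lintegral_one, measure_univ, mul_one]
  exact ENNReal.prod_lt_top fun k _ => ENNReal.ofReal_lt_top

/-- After the time horizon of the minorization and majorization of the chain, the conditional
densities for all initial states are comparable, with constants that depend neither on the number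
of observations nor on the parameter. -/
lemma exists_condDensity_mem_Icc (h : M.ChainAssumptions) (hd : M.DensityBounds) (ω : M.Path) :
    ∃ p : ℕ, ∃ c C : ℝ, 0 < c ∧ 0 < C ∧ ∀ n, p ≤ n → ∀ θ : M.Θ, ∃ A : ℝ, 0 < A ∧
      ∀ x₀ : M.𝒳, M.condDensity n θ x₀ ω ∈ Set.Icc (c * A) (C * A) := by
  obtain ⟨p, hp, σm, σp, hσm, hσ⟩ := h.bounds_p_step
  have : Nonempty M.𝒳 := ⟨M.X 0 ω⟩
  have x' : M.𝒳 := Classical.arbitrary _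
  have hσp : 0 < σp := hσm.trans_le ((hσ M.θstar x' x').1.trans (hσ M.θstar x' x').2)
  have hbm := hd.pathBMinus_pos ω
  have hbp (k : ℕ) : 0 < M.pathBPlus ω k := by
    have h1 := (ofReal_pathBMinus_le_obsLik M.θstar ω k x').trans
      (hd.obsLik_le_ofReal_pathBPlus M.θstar ω k x')
    exact ENNReal.ofReal_pos.1 ((ENNReal.ofReal_pos.2 (hbm k)).trans_le h1)
  have hc : 0 < (∏ k ∈ Finset.range p, M.pathBMinus ω k) * σm :=
    mul_pos (Finset.prod_pos fun k _ => hbm k) hσm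
  have hC : 0 < (∏ k ∈ Finset.range p, M.pathBPlus ω k) * σp :=
    mul_pos (Finset.prod_pos fun k _ => hbp k) hσp
  refine ⟨p, _, _, hc, hC, fun n hn θ => ?_⟩
  obtain ⟨m, rfl⟩ := Nat.exists_eq_add_of_le hn
  -- Likelihood of the observations after time `p`, as a function of the hidden state at time `p`.
  set F := (M.Q θ).feynmanKac (fun _ => 1) m fun k => M.obsLik θ ω (k + p) with hF
  have hFm : Measurable F :=
    Kernel.measurable_feynmanKac _ measurable_const m fun k => measurable_obsLik θ ω (k + p)
  have hqm (x : M.𝒳) : Measurable fun x' => ENNReal.ofReal (M.q θ p x x') :=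
    ENNReal.measurable_ofReal.comp ((M.measurable_q θ p).comp measurable_prodMk_left)
  have hpow (x : M.𝒳) : ∫⁻ y, F y ∂(M.Q θ ^ p) x =
      ∫⁻ y, ENNReal.ofReal (M.q θ p x y) * F y ∂M.μ := by
    rw [h.density θ p hp x, lintegral_withDensity_eq_lintegral_mul _ (hqm x) hFm]
    rfl
  set I := ∫⁻ y, F y ∂M.μ with hI
  have hlow (x : M.𝒳) :
      ENNReal.ofReal ((∏ k ∈ Finset.range p, M.pathBMinus ω k) * σm) * I ≤
        (M.Q θ).feynmanKac (fun _ => 1) (p + m) (M.obsLik θ ω) x := by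
    rw [Kernel.feynmanKac_add, ENNReal.ofReal_mul (Finset.prod_nonneg fun k _ => (hbm k).le),
      ENNReal.ofReal_prod_of_nonneg fun k _ => (hbm k).le, mul_assoc]
    refine le_trans ?_ (Kernel.prod_mul_lintegral_pow_le_feynmanKac (M.Q θ) hFm p
      (ofReal_pathBMinus_le_obsLik θ ω) x)
    rw [hpow, ← lintegral_const_mul _ hFm]
    gcongr with y
    exact (hσ θ x y).1
  have hup (x : M.𝒳) : (M.Q θ).feynmanKac (fun _ => 1) (p + m) (M.obsLik θ ω) x ≤
      ENNReal.ofReal ((∏ k ∈ Finset.range p, M.pathBPlus ω k) * σp) * I := by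
    rw [Kernel.feynmanKac_add, ENNReal.ofReal_mul (Finset.prod_nonneg fun k _ => (hbp k).le),
      ENNReal.ofReal_prod_of_nonneg fun k _ => (hbp k).le, mul_assoc]
    refine (Kernel.feynmanKac_le_prod_mul_lintegral_pow (M.Q θ) hFm p
      (hd.obsLik_le_ofReal_pathBPlus θ ω) x).trans ?_
    rw [hpow, ← lintegral_const_mul _ hFm]
    gcongr with y
    exact (hσ θ x y).2
  -- The bounds are used crosswise: the lower one with a finite likelihood makes `I` finite, the
  -- upper one with a positive likelihood makes it nonzero.
  have hI_top : I ≠ ∞ := fun hI' => by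
    have := (hlow x').trans_lt (feynmanKac_obsLik_lt_top hd (p + m) θ x' ω)
    rw [hI', ENNReal.mul_top (ENNReal.ofReal_pos.2 hc).ne'] at this
    exact lt_irrefl _ this
  have hI_pos : I ≠ 0 := fun hI' => by
    have := (feynmanKac_obsLik_pos hd (p + m) θ x' ω).trans_le (hup x')
    rw [hI', mul_zero] at this
    exact lt_irrefl _ this
  refine ⟨I.toReal, ENNReal.toReal_pos hI_pos hI_top, fun x => ?_⟩
  rw [h.condDensity_eq]
  constructor
  · have := ENNReal.toReal_mono (feynmanKac_obsLik_lt_top hd (p + m) θ x ω).ne (hlow x)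
    rwa [ENNReal.toReal_mul, ENNReal.toReal_ofReal hc.le] at this
  · have := ENNReal.toReal_mono (ENNReal.mul_ne_top ENNReal.ofReal_ne_top hI_top) (hup x)
    rwa [ENNReal.toReal_mul, ENNReal.toReal_ofReal hC.le] at this

end RegimeSwitchingModel

theorem lemma2 (M : RegimeSwitchingModel)
    (h_chain : M.ChainAssumptions) (h_dep : M.DependenceAssumptions) (h_dens : M.DensityBounds)
    (h_log : M.LogMoments) (h_tail : M.RatioTail)
    (κ : M.Θ → ∀ n : ℕ, Kernel ((Fin M.s → M.𝒴) × (Set.Icc (0 : ℤ) n → M.𝒲)) M.𝒳)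
    (hκ : M.IsInitialLaw κ) :
    ∀ᵐ ω ∂(M.P M.θstar),
      Tendsto (fun n : ℕ =>
          (⨆ x₀ : M.𝒳, ⨆ θ : M.Θ, ‖M.condLogLik n θ x₀ ω - M.statLogLik κ n θ ω‖ₑ) / (n : ℝ≥0∞))
        atTop (𝓝 0) := by
  refine Eventually.of_forall fun ω => ?_
  obtain ⟨p, c, C, hc, hC, hbound⟩ :=
    RegimeSwitchingModel.exists_condDensity_mem_Icc h_chain h_dens ω
  refine ENNReal.tendsto_div_natCast_of_eventually_le (K := ENNReal.ofReal (Real.log (C / c)))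
    ENNReal.ofReal_ne_top ?_
  -- The finitely many `n < p`, where the comparison is not available, do not affect the limit.
  filter_upwards [eventually_ge_atTop p] with n hn
  refine iSup₂_le fun x₀ θ => ?_
  obtain ⟨A, hA, hmem⟩ := hbound n hn θ
  have := hκ.isMarkovKernel θ n
  have hint : Integrable (fun x => M.condDensity n θ x ω) (κ θ n (M.initialData n ω)) :=
    Integrable.of_mem_Icc _ _ (h_chain.measurable_condDensity n θ ω).aemeasurable
      (Eventually.of_forall hmem)
  have hstat : ∫ x, M.condDensity n θ x ω ∂(κ θ n (M.initialData n ω)) ∈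
      Set.Icc (c * A) (C * A) := by
    constructor
    · simpa using integral_mono (integrable_const (c * A)) hint fun x => (hmem x).1
    · simpa using integral_mono hint (integrable_const (C * A)) fun x => (hmem x).2
  have hlog := Real.abs_log_sub_log_le_of_mem_Icc (mul_pos hc hA) (hmem x₀) hstat
  -- Cancelling `A` removes all dependence on `n` and `θ`.
  rw [mul_div_mul_right _ _ hA.ne'] at hlog
  rw [← ofReal_norm, Real.norm_eq_abs]
  exact ENNReal.ofReal_le_ofReal hlog
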